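/- Let $\mathcal H$ be an infinite-dimensional separable complex Hilbert space and let $T$ be a bounded linear operator on $\mathcal H$. Notation. For a bounded operator $S$ on a complex Banach space let $\mathcal N(S)$, $\mathcal R(S)$ be its kernel and range, $\alpha(S)=\dim\mathcal N(S)$ and $\beta(S)=\operatorname{codim}\mathcal R(S)$, with values in $\mathbb N\cup\{\infty\}$. $S$ is upper (lower) semi-Fredholm if $\mathcal R(S)$ is closed and $\alpha(S)<\infty$ ($\beta(S)<\infty$); it is semi-Fredholm if it is upper or lower semi-Fredholm, with index $\operatorname{ind}(S)=\alpha(S)-\beta(S)$, and Fredholm if it is both. $S$ is Browder if it is Fredholm and its ascent (the least $n$ with $\mathcal N(S^n)=\mathcal N(S^{n+1})$) and its descent (the least $n$ with $\mathcal R(S^n)=\mathcal R(S^{n+1})$) are finite and equal. Let $\sigma(S)$ be the spectrum and put $$\sigma_a(S)=\{\lambda\in\mathbb C: S-\lambda I\text{ is not bounded below}\},$$ $$\sigma_{uw}(S)=\{\lambda\in\mathbb C: S-\lambda I\text{ is not semi-Fredholm with index }\le 0\},$$ $$\sigma_b(S)=\{\lambda\in\mathbb C: S-\lambda I\text{ is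 not Browder}\},$$ $$E(S)=\{\lambda\in\operatorname{iso}\sigma(S): \alpha(S-\lambda I)>0\},\qquad E_0(S)=\{\lambda\in\operatorname{iso}\sigma(S): 0<\alpha(S-\lambda I)<\infty\},$$ where $\operatorname{iso}$ denotes the set of isolated points. $S$ satisfies property $(UW_E)$ if $\sigma_a(S)\setminus\sigma_{uw}(S)=E(S)$. $T$ is hypercyclic if $\{T^nx: n\ge 0\}$ is dense in $\mathcal H$ for some $x\in\mathcal H$, and supercyclic if $\{\lambda T^nx: n\ge 0,\ \lambda\in\mathbb C\}$ is dense in $\mathcal H$ for some $x\in\mathcal H$. (1) If $T$ is hypercyclic, then $T$ satisfies property $(UW_E)$ if and only if $E(T)=\emptyset$. (2) Let $T$ be supercyclic with $E(T)\subseteq E_0(T^*)$, where $T^*$ may be read either as the Hilbert space adjoint of $T$ or as the Banach space adjoint $f\mapsto f\circ T$ on the dual of $\mathcal H$. Then $T$ satisfies property $(UW_E)$ if and only if there is an $\alpha\in\mathbb C\setminus\sigma_b(T)$ such that $E(T)\subseteq\{\alpha\}$. -/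

import Mathlib

noncomputable section

namespace WeylType

variable {X : Type*} [NormedAddCommGroup X] [NormedSpace ℂ X]

/-- The nullity `α(T) = dim N(T)`, with values in `ℕ ∪ {∞}`. -/
def nullity (T : X →L[ℂ] X) : ℕ∞ :=
  Cardinal.toENat (Module.rank ℂ T.ker)

/-- The defect `β(T) = dim X / R(T)`, with values in `ℕ ∪ {∞}`. -/
def defect (T : X →L[ℂ] X) : ℕ∞ :=
  Cardinal.toENat (Module.rank ℂ (X ⧸ T.range))

/-- Upper semi-Fredholm operators: finite nullity and closed range. -/
def IsUpperSemiFredholm (T : X →L[ℂ] X) : Prop :=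
  nullity T < ⊤ ∧ IsClosed (T.range : Set X)

/-- Lower semi-Fredholm operators: finite defect and closed range. -/
def IsLowerSemiFredholm (T : X →L[ℂ] X) : Prop :=
  defect T < ⊤ ∧ IsClosed (T.range : Set X)

/-- Semi-Fredholm operators: upper or lower semi-Fredholm. -/
def IsSemiFredholm (T : X →L[ℂ] X) : Prop :=
  IsUpperSemiFredholm T ∨ IsLowerSemiFredholm T

/-- Fredholm operators: upper and lower semi-Fredholm. -/
def IsFredholm (T : X →L[ℂ] X) : Prop :=
  IsUpperSemiFredholm T ∧ IsLowerSemiFredholm T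

/-- The index `ind(T) = α(T) - β(T)`, an extended real. It is only used for semi-Fredholm
operators, for which `α(T)` and `β(T)` are not both infinite. -/
def index (T : X →L[ℂ] X) : EReal :=
  (((nullity T : ℕ∞) : ENNReal) : EReal) - (((defect T : ℕ∞) : ENNReal) : EReal)

/-- Upper semi-Weyl operators: semi-Fredholm with index at most zero. -/
def IsUpperSemiWeyl (T : X →L[ℂ] X) : Prop :=
  IsSemiFredholm T ∧ index T ≤ 0

/-- The ascent: the least `n` with `N(Tⁿ) = N(Tⁿ⁺¹)`, or `∞` if there is none. -/
def ascent (T : X →L[ℂ] X) : ℕ∞ :=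
  ⨅ (n : ℕ) (_ : (T ^ n).ker = (T ^ (n + 1)).ker), (n : ℕ∞)

/-- The descent: the least `n` with `R(Tⁿ) = R(Tⁿ⁺¹)`, or `∞` if there is none. -/
def descent (T : X →L[ℂ] X) : ℕ∞ :=
  ⨅ (n : ℕ) (_ : (T ^ n).range = (T ^ (n + 1)).range), (n : ℕ∞)

/-- Browder operators: Fredholm with equal finite ascent and descent. -/
def IsBrowder (T : X →L[ℂ] X) : Prop :=
  IsFredholm T ∧ ascent T = descent T ∧ ascent T < ⊤

/-- The approximate point spectrum: `T - z` is not bounded below. -/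
def approxSpectrum (T : X →L[ℂ] X) : Set ℂ :=
  {z | ¬ ∃ c : ℝ, 0 < c ∧ ∀ x : X, c * ‖x‖ ≤ ‖(T - z • (1 : X →L[ℂ] X)) x‖}

/-- The upper semi-Weyl spectrum. -/
def upperWeylSpectrum (T : X →L[ℂ] X) : Set ℂ :=
  {z | ¬ IsUpperSemiWeyl (T - z • (1 : X →L[ℂ] X))}

/-- The Browder spectrum. -/
def browderSpectrum (T : X →L[ℂ] X) : Set ℂ :=
  {z | ¬ IsBrowder (T - z • (1 : X →L[ℂ] X))}

/-- The isolated points of a set of complex numbers. -/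
def iso (S : Set ℂ) : Set ℂ :=
  {z | ∃ r : ℝ, 0 < r ∧ S ∩ Metric.ball z r = {z}}

/-- `E(T)`: the isolated points of the spectrum that are eigenvalues. -/
def E (T : X →L[ℂ] X) : Set ℂ :=
  {z | z ∈ iso (spectrum ℂ T) ∧ 0 < nullity (T - z • (1 : X →L[ℂ] X))}

/-- `E₀(T)`: the isolated points of the spectrum that are eigenvalues of finite multiplicity. -/
def E₀ (T : X →L[ℂ] X) : Set ℂ :=
  {z | z ∈ iso (spectrum ℂ T) ∧ 0 < nullity (T - z • (1 : X →L[ℂ] X)) ∧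
    nullity (T - z • (1 : X →L[ℂ] X)) < ⊤}

/-- Property `(UW_E)`. -/
def PropertyUWE (T : X →L[ℂ] X) : Prop :=
  approxSpectrum T \ upperWeylSpectrum T = E T

/-- Some vector has a dense orbit. -/
def IsHypercyclic (T : X →L[ℂ] X) : Prop :=
  ∃ x : X, Dense {y : X | ∃ n : ℕ, y = (T ^ n) x}

/-- The scalar multiples of the orbit of some vector are dense. -/
def IsSupercyclic (T : X →L[ℂ] X) : Prop :=
  ∃ x : X, Dense {y : X | ∃ (c : ℂ) (n : ℕ), y = c • (T ^ n) x}

/-- The Banach space adjoint `f ↦ f ∘ T` on the continuous dual. -/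
def dualAdjoint (T : X →L[ℂ] X) : StrongDual ℂ X →L[ℂ] StrongDual ℂ X :=
  ContinuousLinearMap.precomp ℂ T

end WeylType

end

open Filter Topology

namespace WeylType

section Dynamics

variable {X : Type*} [NormedAddCommGroup X] [NormedSpace ℂ X] {T : X →L[ℂ] X}

/-- A closed subspace is separated from a point outside it by a functional vanishing on it. -/
lemma exists_dual_eq_zero_of_notMem {R : Submodule ℂ X} (hR : IsClosed (R : Set X)) {y : X}
    (hy : y ∉ R) : ∃ f : StrongDual ℂ X, (∀ x ∈ R, f x = 0) ∧ f y ≠ 0 := by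
  have : IsClosed (R : Set X) := hR
  have hne : R.mkQ y ≠ 0 := by simpa using hy
  obtain ⟨g, -, hg⟩ := exists_dual_vector ℂ (R.mkQ y) (norm_ne_zero_iff.2 hne)
  refine ⟨g.comp R.mkQL, fun x hx => ?_, ?_⟩
  · have : R.mkQL x = 0 := by simpa using hx
    simp [this]
  · change g (R.mkQ y) ≠ 0
    rw [hg]
    simpa using hne

lemma dual_apply_pow {f : StrongDual ℂ X} {a : ℂ} (hf : ∀ x, f (T x) = a * f x) (n : ℕ) (x : X) :
    f ((T ^ n) x) = a ^ n * f x := by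
  induction n with
  | zero => simp
  | succ n ih => rw [pow_succ', mul_apply_eq_comp, hf, ih]; ring

lemma IsHypercyclic.exists_forall_of_isClosed (hT : IsHypercyclic T) :
    ∃ x : X, ∀ {p : X → Prop}, IsClosed {y | p y} → (∀ n : ℕ, p ((T ^ n) x)) → ∀ y, p y := by
  obtain ⟨x, hx⟩ := hT
  refine ⟨x, fun hp h y => hp.closure_subset_iff.2 ?_ (hx y)⟩
  rintro _ ⟨n, rfl⟩
  exact h n

lemma IsSupercyclic.exists_forall_of_isClosed (hT : IsSupercyclic T) :
    ∃ x : X, ∀ {p : X → Prop}, IsClosed {y | p y} →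
      (∀ (c : ℂ) (n : ℕ), p (c • (T ^ n) x)) → ∀ y, p y := by
  obtain ⟨x, hx⟩ := hT
  refine ⟨x, fun hp h y => hp.closure_subset_iff.2 ?_ (hx y)⟩
  rintro _ ⟨c, n, rfl⟩
  exact h c n

/-- The adjoint of a hypercyclic operator has no eigenvalues. -/
lemma IsHypercyclic.dual_eq_zero (hT : IsHypercyclic T) {f : StrongDual ℂ X} {a : ℂ}
    (hf : ∀ x, f (T x) = a * f x) : f = 0 := by
  obtain ⟨x, hext⟩ := hT.exists_forall_of_isClosed
  have hfx : f x = 0 := by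
    rcases le_total ‖a‖ 1 with ha | ha
    · by_contra hne
      have h := hext (p := fun y => ‖f y‖ ≤ ‖f x‖) (isClosed_le (by fun_prop) (by fun_prop))
        (fun n => by
          rw [dual_apply_pow hf, norm_mul, norm_pow]
          exact mul_le_of_le_one_left (norm_nonneg _) (pow_le_one₀ (norm_nonneg _) ha))
      have h2 := h ((2 : ℂ) • x)
      rw [map_smul, smul_eq_mul, norm_mul] at h2
      have : 0 < ‖f x‖ := norm_pos_iff.2 hne
      norm_num at h2
      linarith
    · have h := hext (p := fun y => ‖f x‖ ≤ ‖f y‖) (isClosed_le (by fun_prop) (by fun_prop))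
        (fun n => by
          rw [dual_apply_pow hf, norm_mul, norm_pow]
          exact le_mul_of_one_le_left (norm_nonneg _) (one_le_pow₀ ha))
      simpa using h 0
  ext y
  exact hext (p := fun y => f y = 0) (isClosed_eq (by fun_prop) (by fun_prop))
    (fun n => by rw [dual_apply_pow hf, hfx, mul_zero]) y

/-- Two eigenvectors of the adjoint of a supercyclic operator are proportional. -/
lemma IsSupercyclic.ker_dual_le (hT : IsSupercyclic T) {f g : StrongDual ℂ X} {a b : ℂ}
    (hf : ∀ x, f (T x) = a * f x) (hg : ∀ x, g (T x) = b * g x) (hf0 : f ≠ 0) (hg0 : g ≠ 0) {y : X}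
    (hy : f y = 0) : g y = 0 := by
  obtain ⟨x, hext⟩ := hT.exists_forall_of_isClosed
  have hne : ∀ {h : StrongDual ℂ X} {c : ℂ}, (∀ x, h (T x) = c * h x) → h ≠ 0 → h x ≠ 0 := by
    intro h c hh h0 hxh
    refine h0 (ContinuousLinearMap.ext fun y => ?_)
    exact hext (p := fun y => h y = 0) (isClosed_eq (by fun_prop) (by fun_prop))
      (fun d n => by rw [map_smul, dual_apply_pow hh, hxh, mul_zero, smul_zero]) y
  have hfx := norm_pos_iff.2 (hne hf hf0)
  have hgx := norm_pos_iff.2 (hne hg hg0)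
  have key : ∀ {h k : StrongDual ℂ X} {c d : ℂ}, (∀ x, h (T x) = c * h x) →
      (∀ x, k (T x) = d * k x) → ‖c‖ ≤ ‖d‖ → ∀ y, ‖h y‖ * ‖k x‖ ≤ ‖k y‖ * ‖h x‖ := by
    intro h k c d hh hk hcd
    refine hext (isClosed_le (by fun_prop) (by fun_prop)) fun e n => ?_
    rw [map_smul, map_smul, dual_apply_pow hh, dual_apply_pow hk]
    simp only [smul_eq_mul, norm_mul, norm_pow]
    have : ‖c‖ ^ n ≤ ‖d‖ ^ n := pow_le_pow_left₀ (norm_nonneg _) hcd n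
    calc ‖e‖ * (‖c‖ ^ n * ‖h x‖) * ‖k x‖ = ‖c‖ ^ n * (‖e‖ * ‖h x‖ * ‖k x‖) := by ring
      _ ≤ ‖d‖ ^ n * (‖e‖ * ‖h x‖ * ‖k x‖) := by gcongr
      _ = _ := by ring
  -- one kernel contains the other, and both are hyperplanes
  have swap : ∀ {h k : StrongDual ℂ X}, h x ≠ 0 → k x ≠ 0 → (∀ z, k z = 0 → h z = 0) →
      ∀ z, h z = 0 → k z = 0 := by
    intro h k hhx hkx H z hz
    have h1 : h (z - (k z / k x) • x) = 0 := H _ (by simp [hkx])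
    rw [map_sub, hz, map_smul, smul_eq_mul, zero_sub, neg_eq_zero, mul_eq_zero, div_eq_zero_iff] at h1
    tauto
  rcases le_total ‖a‖ ‖b‖ with hab | hab
  · refine swap (hne hf hf0) (hne hg hg0) (fun z hz => ?_) y hy
    have := key hf hg hab z
    rw [hz, norm_zero, zero_mul] at this
    exact norm_le_zero_iff.1 (nonpos_of_mul_nonpos_left this hgx)
  · have := key hg hf hab y
    rw [hy, norm_zero, zero_mul] at this
    exact norm_le_zero_iff.1 (nonpos_of_mul_nonpos_left this hfx)

/-- The adjoint of a supercyclic operator has no nontrivial Jordan chains. -/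
lemma IsSupercyclic.dual_eq_zero_of_jordan (hT : IsSupercyclic T) {f g : StrongDual ℂ X} {a : ℂ}
    (hf : ∀ x, f (T x) = a * f x) (hg : ∀ x, g (T x) = a * g x + f x) : f = 0 := by
  by_contra hf0
  obtain ⟨x, hext⟩ := hT.exists_forall_of_isClosed
  have hfx : f x ≠ 0 := by
    intro hxf
    refine hf0 (ContinuousLinearMap.ext fun y => ?_)
    exact hext (p := fun y => f y = 0) (isClosed_eq (by fun_prop) (by fun_prop))
      (fun d n => by rw [map_smul, dual_apply_pow hf, hxf, mul_zero, smul_zero]) y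
  -- `g` cannot vanish on `ker f`
  have hker : ∃ z, f z = 0 ∧ g z ≠ 0 := by
    by_contra! H
    have hgf : ∀ y, g y = g x / f x * f y := by
      intro y
      have := H (y - (f y / f x) • x) (by simp [hfx])
      rw [map_sub, map_smul, smul_eq_mul, sub_eq_zero] at this
      rw [this]; ring
    have h1 := hg x
    rw [hgf (T x), hf] at h1
    apply hfx
    have : g x / f x * f x = g x := div_mul_cancel₀ _ hfx
    linear_combination -h1 + a * this
  obtain ⟨z, hz, hgz⟩ := hker
  by_cases ha : a = 0
  · subst ha
    have h : ∀ y, g y * f x * f y = f y * g x * f y := by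
      refine hext (isClosed_eq (by fun_prop) (by fun_prop)) fun c n => ?_
      cases n with
      | zero => simp only [map_smul, smul_eq_mul, pow_zero, one_apply_eq_self]; ring
      | succ n =>
        have : f ((T ^ (n + 1)) x) = 0 := by rw [dual_apply_pow hf]; simp
        simp only [map_smul, this]; simp
    have h1 := h (x + z)
    simp only [map_add, hz, add_zero] at h1
    have : g z * (f x * f x) = 0 := by linear_combination h1
    simp [hgz, hfx] at this
  · have hgn : ∀ n : ℕ, a * g ((T ^ n) x) = a ^ n * (a * g x + n * f x) := by
      intro n
      induction n with
      | zero => simp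
      | succ n ih =>
        rw [pow_succ', mul_apply_eq_comp, hg, dual_apply_pow hf, mul_add, mul_left_comm,
          mul_left_comm a, ih]
        push_cast
        ring
    have h : ∀ y, (a * g y * star (f y)).im * ‖f x‖ ^ 2
        = (a * g x * star (f x)).im * ‖f y‖ ^ 2 := by
      refine hext (isClosed_eq (by fun_prop) (by fun_prop)) fun c n => ?_
      have e1 : a * g (c • (T ^ n) x) * star (f (c • (T ^ n) x))
          = ((‖c * a ^ n‖ ^ 2 : ℝ) : ℂ) * (a * g x * star (f x) + ((n * ‖f x‖ ^ 2 : ℝ) : ℂ)) := by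
        rw [map_smul, map_smul, dual_apply_pow hf, smul_eq_mul, smul_eq_mul, mul_left_comm, hgn]
        push_cast
        rw [← Complex.mul_conj', ← Complex.mul_conj']
        simp only [← starRingEnd_apply, map_mul]
        ring
      rw [e1, Complex.im_ofReal_mul, Complex.add_im, Complex.ofReal_im, map_smul, dual_apply_pow hf]
      simp only [smul_eq_mul, norm_mul]
      ring
    obtain ⟨w, hw⟩ : ∃ w : ℂ, a * g (x + w • z) * star (f x) = a * g x * star (f x) + Complex.I := by
      refine ⟨Complex.I / (a * g z * star (f x)), ?_⟩
      have : star (f x) ≠ 0 := by simpa using hfx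
      rw [map_add, map_smul, smul_eq_mul]
      field_simp
    have h1 := h (x + w • z)
    have h2 : f (x + w • z) = f x := by simp [hz]
    rw [h2, hw, Complex.add_im, Complex.I_im] at h1
    have : 0 < ‖f x‖ ^ 2 := by positivity
    nlinarith

end Dynamics

section SimpleZero

variable {X : Type*} [NormedAddCommGroup X] [NormedSpace ℂ X] {S T : X →L[ℂ] X}

/-- The range of `S` is the kernel of a functional `f`, its kernel is spanned by a vector `u`, and
the two are complementary. -/
def HasSimpleZero (S : X →L[ℂ] X) : Prop :=
  ∃ (f : StrongDual ℂ X) (u : X), (∀ x, f (S x) = 0) ∧ (∀ y, f y = 0 → ∃ x, S x = y) ∧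
    S u = 0 ∧ (∀ x, S x = 0 → ∃ c : ℂ, x = c • u) ∧ f u = 1

lemma nullity_eq_zero_iff : nullity S = 0 ↔ S.ker = ⊥ := by
  simp [nullity]

lemma defect_eq_zero_iff : defect S = 0 ↔ S.range = ⊤ := by
  simp [defect, rank_zero_iff, Submodule.Quotient.subsingleton_iff]

lemma defect_eq_one {f : StrongDual ℂ X} (hf0 : f ≠ 0) (hf : ∀ x, f (S x) = 0)
    (hR : ∀ y, f y = 0 → ∃ x, S x = y) : defect S = 1 := by
  have hker : S.range = f.ker := by
    ext y
    simp only [LinearMap.mem_range, LinearMap.mem_ker, ContinuousLinearMap.coe_coe]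
    exact ⟨by rintro ⟨x, rfl⟩; exact hf x, hR y⟩
  have hs : Function.Surjective (f : X →ₗ[ℂ] ℂ) :=
    LinearMap.surjective (fun h => hf0 (by ext x; exact LinearMap.congr_fun h x))
  have h1 := (LinearMap.quotKerEquivOfSurjective (f : X →ₗ[ℂ] ℂ) hs).finrank_eq
  rw [Module.finrank_self] at h1
  rw [defect, hker, Module.rank_eq_one_iff_finrank_eq_one.2 h1]
  simp

lemma isClosed_range_of_dual {f : StrongDual ℂ X} (hf : ∀ x, f (S x) = 0)
    (hR : ∀ y, f y = 0 → ∃ x, S x = y) : IsClosed (S.range : Set X) := by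
  have : (S.range : Set X) = {y | f y = 0} := by
    ext y
    exact ⟨by rintro ⟨x, rfl⟩; exact hf x, hR y⟩
  rw [this]
  exact isClosed_eq (by fun_prop) (by fun_prop)

lemma HasSimpleZero.defect_eq_one (hS : HasSimpleZero S) : defect S = 1 := by
  obtain ⟨f, u, hf, hR, -, -, hfu⟩ := hS
  exact WeylType.defect_eq_one (by rintro rfl; simp at hfu) hf hR

lemma HasSimpleZero.nullity_eq_one (hS : HasSimpleZero S) : nullity S = 1 := by
  obtain ⟨f, u, -, -, hu, hN, hfu⟩ := hS
  have hu0 : u ≠ 0 := by rintro rfl; simp at hfu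
  have : S.ker = ℂ ∙ u := by
    ext x
    rw [Submodule.mem_span_singleton]
    constructor
    · intro hx
      obtain ⟨c, rfl⟩ := hN x hx
      exact ⟨c, rfl⟩
    · rintro ⟨c, rfl⟩
      simp [hu]
  rw [nullity, this, Module.rank_eq_one_iff_finrank_eq_one.2 (finrank_span_singleton hu0)]
  simp

lemma HasSimpleZero.isFredholm (hS : HasSimpleZero S) : IsFredholm S := by
  have hc : IsClosed (S.range : Set X) := by
    obtain ⟨f, u, hf, hR, -⟩ := hS
    exact isClosed_range_of_dual hf hR
  refine ⟨⟨?_, hc⟩, ?_, hc⟩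
  · rw [hS.nullity_eq_one]; exact ENat.natCast_lt_top 1
  · rw [hS.defect_eq_one]; exact ENat.natCast_lt_top 1

lemma HasSimpleZero.isUpperSemiWeyl (hS : HasSimpleZero S) : IsUpperSemiWeyl S := by
  refine ⟨Or.inl hS.isFredholm.1, ?_⟩
  rw [index, hS.nullity_eq_one, hS.defect_eq_one]
  exact EReal.sub_self_le_zero

lemma iInf_natCast_eq_one {p : ℕ → Prop} (h0 : ¬ p 0) (h1 : p 1) :
    ⨅ (n : ℕ) (_ : p n), (n : ℕ∞) = 1 := by
  refine le_antisymm (iInf₂_le_of_le 1 h1 le_rfl) (le_iInf₂ fun n hn => ?_)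
  have : n ≠ 0 := by rintro rfl; exact h0 hn
  exact_mod_cast Nat.one_le_iff_ne_zero.2 this

lemma range_pow_one_eq_range_pow_two {f : StrongDual ℂ X} {u : X}
    (hR : ∀ y, f y = 0 → ∃ x, S x = y) (hu : S u = 0) (hfu : f u = 1) :
    (S ^ 1).range = (S ^ (1 + 1)).range := by
  rw [one_add_one_eq_two, pow_one, pow_two]
  refine le_antisymm ?_ ?_
  · rintro _ ⟨x, rfl⟩
    obtain ⟨y, hy⟩ := hR (x - f x • u) (by simp [hfu])
    refine ⟨y, ?_⟩
    change S (S y) = S x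
    rw [hy, map_sub, map_smul, hu, smul_zero, sub_zero]
  · rintro _ ⟨x, rfl⟩
    exact ⟨S x, rfl⟩

lemma HasSimpleZero.isBrowder (hS : HasSimpleZero S) : IsBrowder S := by
  have hF := hS.isFredholm
  obtain ⟨f, u, hf, hR, hu, hN, hfu⟩ := hS
  have hu0 : u ≠ 0 := by rintro rfl; simp at hfu
  have ha : ascent S = 1 := by
    refine iInf_natCast_eq_one (fun h => ?_) ?_
    · have : u ∈ (S ^ 0).ker := by rw [h]; simpa using hu
      exact hu0 (by simpa using this)
    · ext x
      rw [one_add_one_eq_two, pow_one, pow_two]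
      refine ⟨fun h => ?_, fun h => ?_⟩
      · have h : S x = 0 := h
        simp [h]
      · obtain ⟨c, hc⟩ := hN (S x) h
        have h1 := hf x
        rw [hc, map_smul, hfu, smul_eq_mul, mul_one] at h1
        change S x = 0
        rw [hc, h1, zero_smul]
  have hd : descent S = 1 := by
    refine iInf_natCast_eq_one (fun h => ?_) ?_
    · have : u ∈ (S ^ (0 + 1)).range := by rw [← h]; exact ⟨u, rfl⟩
      obtain ⟨v, hv⟩ := this
      have hv : S v = u := by simpa using hv
      rw [← hv, hf] at hfu
      exact zero_ne_one hfu
    · exact range_pow_one_eq_range_pow_two hR hu hfu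
  exact ⟨hF, by rw [ha, hd], by rw [ha]; exact ENat.natCast_lt_top 1⟩

lemma mem_approxSpectrum_of_nullity_pos {z : ℂ}
    (h : 0 < nullity (T - z • (1 : X →L[ℂ] X))) : z ∈ approxSpectrum T := by
  rintro ⟨c, hc, H⟩
  rw [pos_iff_ne_zero, Ne, nullity_eq_zero_iff] at h
  refine h (LinearMap.ker_eq_bot'.2 fun x hx => ?_)
  have hx : (T - z • (1 : X →L[ℂ] X)) x = 0 := hx
  have h1 := H x
  rw [hx, norm_zero] at h1
  exact norm_le_zero_iff.1 (nonpos_of_mul_nonpos_right h1 hc)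

lemma mem_spectrum_iff_not_isUnit {z : ℂ} :
    z ∈ spectrum ℂ T ↔ ¬ IsUnit (T - z • (1 : X →L[ℂ] X)) := by
  rw [spectrum.mem_iff, IsUnit.sub_iff, Algebra.algebraMap_eq_smul_one]

variable [CompleteSpace X]

lemma not_mem_approxSpectrum_of_nullity_eq_zero {z : ℂ}
    (h : nullity (T - z • (1 : X →L[ℂ] X)) = 0)
    (hc : IsClosed ((T - z • (1 : X →L[ℂ] X)).range : Set X)) : z ∉ approxSpectrum T := by
  rw [nullity_eq_zero_iff] at h
  obtain ⟨K, H⟩ := ContinuousLinearMap.antilipschitz_of_injective_of_isClosed_range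
    (T - z • (1 : X →L[ℂ] X)) (LinearMap.ker_eq_bot.1 h) hc
  refine not_not.2 ⟨((K : ℝ) + 1)⁻¹, by positivity, fun x => ?_⟩
  rw [inv_mul_le_iff₀ (by positivity)]
  refine (H.le_mul_norm (map_zero _) x).trans ?_
  gcongr
  exact le_add_of_nonneg_right zero_le_one

/-- Near a simple zero of `S`, the operators `S - μ` are invertible. -/
lemma HasSimpleZero.eventually_isUnit (hS : HasSimpleZero S) :
    ∀ᶠ μ in 𝓝[≠] (0 : ℂ), IsUnit (S - μ • (1 : X →L[ℂ] X)) := by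
  obtain ⟨f, u, hf, hR, hu, hN, hfu⟩ := hS
  -- replacing the zero of `S` on its kernel by the identity gives an invertible operator
  set A : X →L[ℂ] X := S + f.smulRight u with hA
  have hAx : ∀ x, A x = S x + f x • u := fun x => by simp [hA]
  have hAu : IsUnit A := by
    rw [ContinuousLinearMap.isUnit_iff_bijective]
    constructor
    · refine (injective_iff_map_eq_zero A).2 fun x hx => ?_
      rw [hAx] at hx
      have h1 : f x = 0 := by simpa [hf, hfu] using congrArg f hx
      rw [h1, zero_smul, add_zero] at hx
      obtain ⟨c, rfl⟩ := hN x hx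
      rw [map_smul, hfu, smul_eq_mul, mul_one] at h1
      rw [h1, zero_smul]
    · intro y
      obtain ⟨z, hz⟩ := hR (y - f y • u) (by simp [hfu])
      refine ⟨z - f z • u + f y • u, ?_⟩
      simp [hAx, hu, hfu, hz]
  have hcont : Tendsto (fun μ : ℂ => A - μ • (1 : X →L[ℂ] X)) (𝓝 0) (𝓝 A) := by
    have : Continuous fun μ : ℂ => A - μ • (1 : X →L[ℂ] X) := by fun_prop
    simpa using this.tendsto 0
  have hev := (hcont.eventually (Units.isOpen.mem_nhds hAu)).filter_mono
    (nhdsWithin_le_nhds (s := {0}ᶜ))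
  filter_upwards [hev, self_mem_nhdsWithin] with μ hμ hμ0
  have hμ0 : μ ≠ 0 := hμ0
  have hμ : IsUnit (A - μ • (1 : X →L[ℂ] X)) := hμ
  rw [ContinuousLinearMap.isUnit_iff_bijective] at hμ ⊢
  constructor
  · refine (injective_iff_map_eq_zero _).2 fun x hx => ?_
    have hx : S x - μ • x = 0 := by simpa using hx
    have h1 : f x = 0 := by simpa [hf, hμ0] using congrArg f hx
    refine (injective_iff_map_eq_zero _).1 hμ.1 x ?_
    simpa [hAx, h1] using hx
  · intro y
    obtain ⟨x, hx⟩ := hμ.2 y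
    have hx : S x + f x • u - μ • x = y := by simpa [hAx] using hx
    refine ⟨x - (f x / μ) • u, ?_⟩
    have : μ • (f x / μ) • u = f x • u := by rw [smul_smul, mul_div_cancel₀ _ hμ0]
    change S (x - (f x / μ) • u) - μ • (x - (f x / μ) • u) = y
    rw [← hx, map_sub, map_smul, hu, smul_zero, smul_sub, this]
    abel

lemma HasSimpleZero.mem_E {z : ℂ} (hS : HasSimpleZero (T - z • (1 : X →L[ℂ] X))) : z ∈ E T := by
  have hpos : 0 < nullity (T - z • (1 : X →L[ℂ] X)) := by
    rw [hS.nullity_eq_one]; exact one_pos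
  refine ⟨?_, hpos⟩
  have hz : z ∈ spectrum ℂ T := by
    rw [mem_spectrum_iff_not_isUnit, ContinuousLinearMap.isUnit_iff_bijective]
    rintro ⟨hinj, -⟩
    exact hpos.ne' (nullity_eq_zero_iff.2 (LinearMap.ker_eq_bot.2 hinj))
  obtain ⟨r, hr, H⟩ := Metric.eventually_nhds_iff.1
    (eventually_nhdsWithin_iff.1 hS.eventually_isUnit)
  refine ⟨r, hr, Set.Subset.antisymm ?_ ?_⟩
  · rintro w ⟨hw, hwr⟩
    by_contra hne
    have h1 := H (y := w - z) (by simpa [dist_eq_norm] using hwr) (sub_ne_zero.2 hne)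
    rw [sub_smul, sub_sub_sub_cancel_right] at h1
    rw [mem_spectrum_iff_not_isUnit] at hw
    apply hw
    convert h1 using 1
  · rintro _ rfl
    exact ⟨hz, Metric.mem_ball_self hr⟩

lemma isBrowder_of_isUnit (hS : IsUnit S) : IsBrowder S := by
  rw [ContinuousLinearMap.isUnit_iff_bijective] at hS
  have hk : S.ker = ⊥ := LinearMap.ker_eq_bot.2 hS.1
  have hr : S.range = ⊤ := LinearMap.range_eq_top.2 hS.2
  have hc : IsClosed (S.range : Set X) := by rw [hr]; exact isClosed_univ
  have ha : ascent S = 0 := by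
    refine nonpos_iff_eq_zero.1 (iInf₂_le_of_le 0 ?_ (by simp))
    rw [zero_add, pow_one, hk]
    exact LinearMap.ker_eq_bot.2 fun _ _ h => h
  have hd : descent S = 0 := by
    refine nonpos_iff_eq_zero.1 (iInf₂_le_of_le 0 ?_ (by simp))
    rw [zero_add, pow_one, hr]
    exact LinearMap.range_eq_top.2 fun x => ⟨x, rfl⟩
  refine ⟨⟨⟨?_, hc⟩, ?_, hc⟩, by rw [ha, hd], by rw [ha]; exact ENat.natCast_lt_top 0⟩
  · rw [nullity_eq_zero_iff.2 hk]; exact ENat.natCast_lt_top 0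
  · rw [defect_eq_zero_iff.2 hr]; exact ENat.natCast_lt_top 0

/-- A functional vanishing on the kernel of an operator with closed range factors through it. -/
lemma exists_dual_comp_eq (hc : IsClosed (S.range : Set X)) {f : StrongDual ℂ X}
    (hf : ∀ x, S x = 0 → f x = 0) : ∃ g : StrongDual ℂ X, ∀ x, g (S x) = f x := by
  have : CompleteSpace S.range := hc.completeSpace_coe
  let π : X →L[ℂ] S.range := S.codRestrict S.range fun x => ⟨x, rfl⟩
  have hπs : Function.Surjective π := by rintro ⟨_, x, rfl⟩; exact ⟨x, rfl⟩
  obtain ⟨s, hs⟩ := (π : X →ₗ[ℂ] S.range).exists_rightInverse_of_surjective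
    (LinearMap.range_eq_top.2 hπs)
  have hs' : ∀ y, π (s y) = y := fun y => LinearMap.congr_fun hs y
  have hfs : ∀ x, f (s (π x)) = f x := fun x => by
    rw [← sub_eq_zero, ← map_sub]
    refine hf _ ?_
    rw [map_sub, sub_eq_zero]
    exact congrArg Subtype.val (hs' (π x))
  let h : StrongDual ℂ S.range := ⟨(f : X →ₗ[ℂ] ℂ).comp s, by
    refine (π.isQuotientMap hπs).continuous_iff.2 ?_
    convert f.continuous using 1
    exact funext hfs⟩
  obtain ⟨g, hg, -⟩ := exists_extension_norm_eq S.range h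
  exact ⟨g, fun x => (hg (π x)).trans (hfs x)⟩

end SimpleZero

section Main

variable {X : Type*} [NormedAddCommGroup X] [NormedSpace ℂ X] {T : X →L[ℂ] X} {z : ℂ}

lemma dual_apply_eq_mul {f : StrongDual ℂ X}
    (hf : ∀ x, f ((T - z • (1 : X →L[ℂ] X)) x) = 0) (x : X) : f (T x) = z * f x := by
  simpa [sub_eq_zero] using hf x

lemma IsUpperSemiWeyl.isClosed_range {S : X →L[ℂ] X} (h : IsUpperSemiWeyl S) :
    IsClosed (S.range : Set X) :=
  h.1.elim (fun h => h.2) fun h => h.2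

lemma IsUpperSemiWeyl.nullity_le_defect {S : X →L[ℂ] X} (h : IsUpperSemiWeyl S) :
    nullity S ≤ defect S := by
  by_contra! hlt
  have hd : defect S ≠ ⊤ := hlt.ne_top
  have h2 := h.2
  rw [index] at h2
  have hlt' : (((defect S : ℕ∞) : ENNReal) : EReal) < (((nullity S : ℕ∞) : ENNReal) : EReal) := by
    exact_mod_cast hlt
  refine absurd h2 (not_le.2 (EReal.sub_pos.2 hlt'))

lemma ker_eq_of_ascent_le_one {S : X →L[ℂ] X} (h : ascent S ≤ 1) {x : X} (hx : S (S x) = 0) :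
    S x = 0 := by
  obtain ⟨n, hn, hk⟩ : ∃ n : ℕ, n ≤ 1 ∧ (S ^ n).ker = (S ^ (n + 1)).ker := by
    by_contra! H
    have : (2 : ℕ∞) ≤ ascent S := by
      refine le_iInf₂ fun n hn => ?_
      by_contra! hlt
      have : n < 2 := by exact_mod_cast hlt
      exact H n (by omega) hn
    exact absurd (this.trans h) (by decide)
  interval_cases n
  · have h1 : S x ∈ (S ^ (0 + 1)).ker := by simpa using hx
    rw [← hk] at h1
    simpa using h1
  · have h1 : x ∈ (S ^ (1 + 1)).ker := by
      rw [pow_succ, pow_one]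
      exact hx
    rw [← hk, pow_one] at h1
    exact h1

/-- A supercyclic operator has at most one simple zero. -/
lemma IsSupercyclic.eq_of_hasSimpleZero (hT : IsSupercyclic T) {w : ℂ}
    (hz : HasSimpleZero (T - z • (1 : X →L[ℂ] X)))
    (hw : HasSimpleZero (T - w • (1 : X →L[ℂ] X))) : z = w := by
  obtain ⟨f, u, hf, -, hu, -, hfu⟩ := hz
  obtain ⟨g, v, hg, -, hv, -, hgv⟩ := hw
  have hf := dual_apply_eq_mul hf
  have hg := dual_apply_eq_mul hg
  have hfv : f v ≠ 0 := fun h => by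
    rw [hT.ker_dual_le hf hg (by rintro rfl; simp at hfu) (by rintro rfl; simp at hgv) h] at hgv
    exact zero_ne_one hgv
  have hTv : T v = w • v := by simpa [sub_eq_zero] using hv
  have h1 := hf v
  rw [hTv, map_smul, smul_eq_mul] at h1
  exact (mul_right_cancel₀ hfv h1).symm

variable [CompleteSpace X]

/-- An operator that is upper semi-Weyl but not bounded below has a proper range. -/
lemma exists_dual_of_mem_diff (hz : z ∈ approxSpectrum T \ upperWeylSpectrum T) :
    ∃ f : StrongDual ℂ X, f ≠ 0 ∧ ∀ x, f ((T - z • (1 : X →L[ℂ] X)) x) = 0 := by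
  have hW : IsUpperSemiWeyl (T - z • (1 : X →L[ℂ] X)) := not_not.1 hz.2
  have hR : (T - z • (1 : X →L[ℂ] X)).range ≠ ⊤ := by
    intro h
    refine not_mem_approxSpectrum_of_nullity_eq_zero ?_ hW.isClosed_range hz.1
    have := hW.nullity_le_defect
    rwa [defect_eq_zero_iff.2 h, nonpos_iff_eq_zero] at this
  obtain ⟨y, hy⟩ : ∃ y, y ∉ (T - z • (1 : X →L[ℂ] X)).range := by
    by_contra! h
    exact hR (eq_top_iff.2 fun y _ => h y)
  obtain ⟨f, hf, hfy⟩ := exists_dual_eq_zero_of_notMem hW.isClosed_range hy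
  exact ⟨f, by rintro rfl; simp at hfy, fun x => hf _ ⟨x, rfl⟩⟩

lemma IsHypercyclic.propertyUWE_iff (hT : IsHypercyclic T) : PropertyUWE T ↔ E T = ∅ := by
  have : approxSpectrum T \ upperWeylSpectrum T = ∅ := by
    refine Set.eq_empty_of_forall_notMem fun z hz => ?_
    obtain ⟨f, hf0, hf⟩ := exists_dual_of_mem_diff hz
    exact hf0 (hT.dual_eq_zero (dual_apply_eq_mul hf))
  rw [PropertyUWE, this, eq_comm]

/-- For a supercyclic operator, a proper closed range of `T - z` is a hyperplane that does not
contain the kernel of `T - z`. -/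
lemma IsSupercyclic.range_eq_ker (hT : IsSupercyclic T)
    (hc : IsClosed ((T - z • (1 : X →L[ℂ] X)).range : Set X)) {f : StrongDual ℂ X} (hf0 : f ≠ 0)
    (hf : ∀ x, f ((T - z • (1 : X →L[ℂ] X)) x) = 0) :
    (∀ y, f y = 0 → ∃ x, (T - z • (1 : X →L[ℂ] X)) x = y) ∧
      ∃ u, (T - z • (1 : X →L[ℂ] X)) u = 0 ∧ f u = 1 := by
  constructor
  · intro y hy
    by_contra hne
    obtain ⟨g, hg, hgy⟩ := exists_dual_eq_zero_of_notMem hc (y := y) (by simpa using hne)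
    exact hgy (hT.ker_dual_le (dual_apply_eq_mul hf)
      (dual_apply_eq_mul fun x => hg _ ⟨x, rfl⟩) hf0 (by rintro rfl; simp at hgy) hy)
  · by_contra! H
    have hker : ∀ x, (T - z • (1 : X →L[ℂ] X)) x = 0 → f x = 0 := by
      intro x hx
      by_contra hne
      exact H ((f x)⁻¹ • x) (by rw [map_smul, hx, smul_zero]) (by simp [hne])
    obtain ⟨g, hg⟩ := exists_dual_comp_eq hc hker
    refine hf0 (hT.dual_eq_zero_of_jordan (dual_apply_eq_mul hf) (g := g) fun x => ?_)
    rw [← hg x]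
    simp

lemma IsSupercyclic.hasSimpleZero_of_mem_diff (hT : IsSupercyclic T)
    (hz : z ∈ approxSpectrum T \ upperWeylSpectrum T) :
    HasSimpleZero (T - z • (1 : X →L[ℂ] X)) := by
  have hW : IsUpperSemiWeyl (T - z • (1 : X →L[ℂ] X)) := not_not.1 hz.2
  obtain ⟨f, hf0, hf⟩ := exists_dual_of_mem_diff hz
  obtain ⟨hR, u, hu, hfu⟩ := hT.range_eq_ker hW.isClosed_range hf0 hf
  refine ⟨f, u, hf, hR, hu, fun x hx => ?_, hfu⟩
  have h1 := hW.nullity_le_defect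
  rw [defect_eq_one hf0 hf hR, nullity] at h1
  have h2 : Module.rank ℂ (T - z • (1 : X →L[ℂ] X)).ker ≤ 1 := by
    simpa using h1
  obtain ⟨v, hv⟩ := (rank_submodule_le_one_iff' _).1 h2
  obtain ⟨c, rfl⟩ := Submodule.mem_span_singleton.1 (hv (show u ∈ _ from hu))
  obtain ⟨d, rfl⟩ := Submodule.mem_span_singleton.1 (hv (show x ∈ _ from hx))
  have hc0 : c ≠ 0 := by rintro rfl; simp at hfu
  exact ⟨d / c, by rw [smul_smul, div_mul_cancel₀ _ hc0]⟩

lemma IsSupercyclic.hasSimpleZero_of_isBrowder (hT : IsSupercyclic T)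
    (hB : IsBrowder (T - z • (1 : X →L[ℂ] X)))
    (hpos : 0 < nullity (T - z • (1 : X →L[ℂ] X))) :
    HasSimpleZero (T - z • (1 : X →L[ℂ] X)) := by
  obtain ⟨⟨⟨-, hc⟩, -⟩, had, -⟩ := hB
  by_cases hR : (T - z • (1 : X →L[ℂ] X)).range = ⊤
  · have hd : ascent (T - z • (1 : X →L[ℂ] X)) ≤ 1 := by
      rw [had]
      refine iInf₂_le_of_le 0 ?_ (by simp)
      rw [zero_add, pow_one, hR]
      exact LinearMap.range_eq_top.2 fun x => ⟨x, rfl⟩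
    refine absurd (nullity_eq_zero_iff.2 (LinearMap.ker_eq_bot'.2 fun x hx => ?_)) hpos.ne'
    obtain ⟨y, rfl⟩ := LinearMap.range_eq_top.1 hR x
    exact ker_eq_of_ascent_le_one hd hx
  · obtain ⟨y, hy⟩ : ∃ y, y ∉ (T - z • (1 : X →L[ℂ] X)).range := by
      by_contra! h
      exact hR (eq_top_iff.2 fun y _ => h y)
    obtain ⟨f, hf, hfy⟩ := exists_dual_eq_zero_of_notMem hc hy
    have hf0 : f ≠ 0 := by rintro rfl; simp at hfy
    have hf : ∀ x, f ((T - z • (1 : X →L[ℂ] X)) x) = 0 := fun x => hf _ ⟨x, rfl⟩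
    obtain ⟨hR, u, hu, hfu⟩ := hT.range_eq_ker hc hf0 hf
    have hd : ascent (T - z • (1 : X →L[ℂ] X)) ≤ 1 := by
      rw [had]
      exact iInf₂_le_of_le 1 (range_pow_one_eq_range_pow_two hR hu hfu) le_rfl
    refine ⟨f, u, hf, hR, hu, fun x hx => ⟨f x, ?_⟩, hfu⟩
    have h0 : (T - z • (1 : X →L[ℂ] X)) (x - f x • u) = 0 := by
      rw [map_sub, map_smul, hu, hx, smul_zero, sub_zero]
    obtain ⟨v, hv⟩ := hR (x - f x • u) (by simp [hfu])
    rw [← hv] at h0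
    rw [← sub_eq_zero, ← hv]
    exact ker_eq_of_ascent_le_one hd h0

lemma IsSupercyclic.propertyUWE_iff [Nontrivial X] (hT : IsSupercyclic T) :
    PropertyUWE T ↔ ∃ α : ℂ, α ∉ browderSpectrum T ∧ E T ⊆ {α} := by
  constructor
  · intro h
    rcases (E T).eq_empty_or_nonempty with h0 | ⟨α, hα⟩
    · obtain ⟨α, hα⟩ : ∃ α : ℂ, ‖T‖ < ‖α‖ :=
        ⟨((‖T‖ + 1 : ℝ) : ℂ), by
          rw [Complex.norm_real, Real.norm_eq_abs]
          exact (lt_add_one _).trans_le (le_abs_self _)⟩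
      have hρ := spectrum.mem_resolventSet_of_norm_lt hα
      refine ⟨α, not_not.2 (isBrowder_of_isUnit ?_), by simp [h0]⟩
      exact not_not.1 fun h => mem_spectrum_iff_not_isUnit.2 h hρ
    · rw [PropertyUWE] at h
      have hs : ∀ z ∈ E T, HasSimpleZero (T - z • (1 : X →L[ℂ] X)) := fun z hz =>
        hT.hasSimpleZero_of_mem_diff (h ▸ hz)
      exact ⟨α, not_not.2 (hs α hα).isBrowder, fun z hz =>
        hT.eq_of_hasSimpleZero (hs z hz) (hs α hα)⟩
  · rintro ⟨α, hα, hE⟩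
    refine Set.Subset.antisymm (fun z hz => (hT.hasSimpleZero_of_mem_diff hz).mem_E)
      fun z hz => ⟨mem_approxSpectrum_of_nullity_pos hz.2, not_not.2 ?_⟩
    obtain rfl : z = α := hE hz
    exact (hT.hasSimpleZero_of_isBrowder (not_not.1 hα) hz.2).isUpperSemiWeyl

end Main

end WeylType

open WeylType in
theorem theorem3p1 {H : Type*} [NormedAddCommGroup H] [InnerProductSpace ℂ H] [CompleteSpace H]
    [TopologicalSpace.SeparableSpace H] (hH : ¬ FiniteDimensional ℂ H) (T : H →L[ℂ] H) :
    (IsHypercyclic T → (PropertyUWE T ↔ E T = ∅)) ∧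
    (IsSupercyclic T →
      (E T ⊆ E₀ (ContinuousLinearMap.adjoint T) ∨ E T ⊆ E₀ (dualAdjoint T)) →
      (PropertyUWE T ↔ ∃ α : ℂ, α ∉ browderSpectrum T ∧ E T ⊆ {α})) := by
  have : Nontrivial H := by
    by_contra h
    have := not_nontrivial_iff_subsingleton.1 h
    exact hH inferInstance
  exact ⟨fun hT => hT.propertyUWE_iff, fun hT _ => hT.propertyUWE_iff⟩
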